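/- Let $p\equiv 1\pmod 4$ and $q\equiv 3\pmod 4$ be primes with $q-p=2$, and put $N=pq$. Let $g$ be a common primitive root of $p$ and $q$, let $x$ be the solution (unique modulo $N$) of $x\equiv g\pmod p$, $x\equiv 1\pmod q$, and define $$D_i=\{g^{s}x^{i}\bmod N: 0\le s<(p-1)(q-1)/2\},$$ $$D_i^{(p)}=\{g^{2t+i}\bmod p: 0\le t<(p-1)/2\},\qquad D_i^{(q)}=\{g^{2t+i}\bmod q: 0\le t<(q-1)/2\}$$ for $i=0,1$. Then $\mathbb Z_N$ is the disjoint union of $C_0=\{0\}\cup D_0\cup D_0^{(p)}q\cup D_0^{(q)}p$ and $C_1=D_1\cup D_1^{(p)}q\cup D_1^{(q)}p$, and the balanced Whiteman generalized cyclotomic sequence $s=\{s_i\}$ of period $N$ is defined by $s_i=0$ if $i \bmod N\in C_0$ and $s_i=1$ if $i\bmod N\in C_1$. The 2-adic complexity of a binary sequence $s$ of period $N$ is $\varphi_2(s)=\lfloor\log_2(n+1)\rfloor$, where $$\frac{\sum_{i=0}^{N-1}s_i2^i}{2^N-1}=\frac mn,\qquad 0\le m\le n,\quad \gcd(m,n)=1.$$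 Then the 2-adic complexity of the sequence $s$ is maximal, that is, $\varphi_2(s)=N$. -/

import Mathlib

/-- `g` is a primitive root modulo the prime `p`: the class of `g` has multiplicative order `p - 1`
in `ℤ/pℤ`. -/
def IsPrimitiveRootMod (g : ℤ) (p : ℕ) : Prop :=
  orderOf (g : ZMod p) = p - 1

/-- The Whiteman generalized cyclotomic class of order 2,
`D_i = {g ^ s * x ^ i mod pq : s = 0, …, (p - 1)(q - 1)/2 - 1}`. -/
def whitemanClass (p q : ℕ) (g x : ℤ) (i : ℕ) : Finset (ZMod (p * q)) :=
  (Finset.range ((p - 1) * (q - 1) / 2)).image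
    fun s => (g : ZMod (p * q)) ^ s * (x : ZMod (p * q)) ^ i

/-- The classical cyclotomic class of order 2 modulo `p`,
`D_i^(p) = {g ^ (2 t + i) mod p : t = 0, …, (p - 1)/2 - 1}`, as a set of least nonnegative
residues. -/
def cyclotomicClass (p : ℕ) (g : ℤ) (i : ℕ) : Finset ℤ :=
  (Finset.range ((p - 1) / 2)).image fun t => g ^ (2 * t + i) % (p : ℤ)

/-- `D_i^(p) q = {y q : y ∈ D_i^(p)}`, viewed in `ℤ/pqℤ`. -/
def scaledClassP (p q : ℕ) (g : ℤ) (i : ℕ) : Finset (ZMod (p * q)) :=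
  (cyclotomicClass p g i).image fun y => ((y * (q : ℤ) : ℤ) : ZMod (p * q))

/-- `D_i^(q) p = {y p : y ∈ D_i^(q)}`, viewed in `ℤ/pqℤ`. -/
def scaledClassQ (p q : ℕ) (g : ℤ) (i : ℕ) : Finset (ZMod (p * q)) :=
  (cyclotomicClass q g i).image fun y => ((y * (p : ℤ) : ℤ) : ZMod (p * q))

/-- `C₁ = D_1 ∪ D_1^(p) q ∪ D_1^(q) p`. Its complement in `ℤ/pqℤ` is
`C₀ = {0} ∪ D_0 ∪ D_0^(p) q ∪ D_0^(q) p`. -/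
def whitemanSupport (p q : ℕ) (g x : ℤ) : Finset (ZMod (p * q)) :=
  whitemanClass p q g x 1 ∪ scaledClassP p q g 1 ∪ scaledClassQ p q g 1

/-- The balanced Whiteman generalized cyclotomic sequence of order 2 and period `pq`:
`s_i = 1` if `i mod pq` lies in `C₁`, and `s_i = 0` otherwise (that is, if it lies in `C₀`). -/
def whitemanSequence (p q : ℕ) (g x : ℤ) (i : ℕ) : ℕ :=
  if (i : ZMod (p * q)) ∈ whitemanSupport p q g x then 1 else 0

/-- The 2-adic complexity of a binary sequence `s` of period `N`: `⌊log₂ (n + 1)⌋`, where `n` is the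
denominator in lowest terms of `(∑_{i < N} s_i 2 ^ i) / (2 ^ N - 1)`. -/
noncomputable def twoAdicComplexity (N : ℕ) (s : ℕ → ℕ) : ℕ :=
  ⌊Real.logb 2
    (((((∑ i ∈ Finset.range N, s i * 2 ^ i : ℕ) : ℚ) / ((2 : ℚ) ^ N - 1)).den : ℝ) + 1)⌋₊

section

open Finset

/-! It suffices that `S = ∑ s_i 2^i` is coprime to `2^N - 1`. If a prime `r` divides both, then `j ↦
2^j` is an additive character of `ℤ/pqℤ` with values in `𝔽_r`, and the sum of `(1 - 2 s_j) 2^j`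
vanishes. In CRT coordinates `1 - 2 s_j` is a combination of quadratic characters and delta
functions, so this sum is `1 + G_p G_q + (q/p) G_p + (p/q) G_q` for quadratic Gauss sums `G_p`,
`G_q` over `𝔽_r` (`sum_whitemanSupport_mul_addChar`). As `p ≡ 1 mod 4`, reciprocity gives `(q/p) =
(p/q) = ε`, and the sum factors as `(1 + ε G_p)(1 + ε G_q)`.

A vanishing factor gives a nontrivial character, hence `p ∣ r - 1` or `q ∣ r - 1`; squaring the
Gauss sum gives `r ∣ p - 1` or `r ∣ q + 1` respectively
(`of_one_add_mul_quadraticGaussSum_eq_zero`). Size and parity exclude both. -/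

/-! ### Cyclotomic classes through quadratic characters -/

theorem IsPrimitiveRootMod.exists_pow_eq {p : ℕ} [Fact p.Prime] {g : ℤ}
    (hg : IsPrimitiveRootMod g p) {y : ZMod p} (hy : y ≠ 0) :
    ∃ k < p - 1, (g : ZMod p) ^ k = y := by
  have h : IsPrimitiveRoot (g : ZMod p) (p - 1) := by
    have h := IsPrimitiveRoot.orderOf (g : ZMod p)
    rwa [hg] at h
  have : NeZero (p - 1) := ⟨by have := (Fact.out : p.Prime).two_le; omega⟩
  exact h.eq_pow_of_pow_eq_one (ZMod.pow_card_sub_one_eq_one hy)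

theorem IsPrimitiveRootMod.pow_eq_pow {p : ℕ} {g : ℤ} (hg : IsPrimitiveRootMod g p) {m n : ℕ}
    (h : m ≡ n [MOD p - 1]) : (g : ZMod p) ^ m = (g : ZMod p) ^ n := by
  rw [← pow_mod_orderOf (g : ZMod p) m, ← pow_mod_orderOf (g : ZMod p) n, hg, h]

theorem IsPrimitiveRootMod.ne_zero {p : ℕ} [Fact p.Prime] {g : ℤ}
    (hg : IsPrimitiveRootMod g p) : (g : ZMod p) ≠ 0 := by
  intro h
  have h2 := (Fact.out : p.Prime).two_le
  have h1 := pow_orderOf_eq_one (g : ZMod p)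
  rw [hg, h, zero_pow (by omega)] at h1
  exact zero_ne_one h1

theorem IsPrimitiveRootMod.quadraticChar_eq {p : ℕ} [Fact p.Prime] {g : ℤ}
    (hg : IsPrimitiveRootMod g p) (hp : p ≠ 2) :
    quadraticChar (ZMod p) (g : ZMod p) = -1 := by
  obtain ⟨a, ha⟩ := quadraticChar_exists_neg_one' (F := ZMod p) (by rwa [ZMod.ringChar_zmod_n])
  obtain ⟨k, -, hk⟩ := hg.exists_pow_eq a.ne_zero
  rcases quadraticChar_dichotomy hg.ne_zero with h | h
  · rw [← hk, map_pow, h, one_pow] at ha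
    norm_num at ha
  · exact h

theorem IsPrimitiveRootMod.quadraticChar_pow {p : ℕ} [Fact p.Prime] {g : ℤ}
    (hg : IsPrimitiveRootMod g p) (hp : p ≠ 2) (k : ℕ) :
    quadraticChar (ZMod p) ((g : ZMod p) ^ k) = (-1) ^ k := by
  rw [map_pow, hg.quadraticChar_eq hp]

theorem quadraticChar_eq_neg_one_ne_zero {p : ℕ} [Fact p.Prime] {y : ZMod p}
    (h : quadraticChar (ZMod p) y = -1) : y ≠ 0 := by
  rintro rfl
  simp at h

theorem mem_cyclotomicClass_one {p : ℕ} [Fact p.Prime] {g : ℤ}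
    (hg : IsPrimitiveRootMod g p) (hp : p ≠ 2) {y : ZMod p} :
    (∃ z ∈ cyclotomicClass p g 1, (z : ZMod p) = y) ↔ quadraticChar (ZMod p) y = -1 := by
  have hodd : p % 2 = 1 := Nat.odd_iff.mp ((Fact.out : p.Prime).odd_of_ne_two hp)
  simp only [cyclotomicClass, mem_image, mem_range]
  constructor
  · rintro ⟨_, ⟨t, -, rfl⟩, rfl⟩
    rw [ZMod.intCast_mod, Int.cast_pow, hg.quadraticChar_pow hp]
    exact Odd.neg_one_pow ⟨t, rfl⟩
  · intro h
    obtain ⟨k, hk, rfl⟩ := hg.exists_pow_eq (quadraticChar_eq_neg_one_ne_zero h)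
    rw [hg.quadraticChar_pow hp, neg_one_pow_eq_neg_one_iff_odd (by norm_num)] at h
    obtain ⟨t, rfl⟩ := h
    exact ⟨_, ⟨t, by omega, rfl⟩, by rw [ZMod.intCast_mod, Int.cast_pow]⟩

/-- In CRT coordinates `g^s x` is `(g^(s+1), g^s)`, whose exponents have opposite parity.
Conversely, opposite parities make the congruences for `s` modulo `p - 1` and `q - 1` compatible,
because the gcd of these moduli is 2. -/
theorem mem_whitemanClass_one {p q : ℕ} [Fact p.Prime] [Fact q.Prime] (hp : p ≠ 2) (hq : q ≠ 2)
    (hgcd : Nat.gcd (p - 1) (q - 1) = 2) (hco : p.Coprime q) {g x : ℤ}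
    (hgp : IsPrimitiveRootMod g p) (hgq : IsPrimitiveRootMod g q)
    (hxp : (x : ZMod p) = g) (hxq : (x : ZMod q) = 1) (j : ZMod (p * q)) :
    j ∈ whitemanClass p q g x 1 ↔
      quadraticChar (ZMod p) (ZMod.chineseRemainder hco j).1 *
        quadraticChar (ZMod q) (ZMod.chineseRemainder hco j).2 = -1 := by
  have h2p := (Fact.out : p.Prime).two_le
  have h2q := (Fact.out : q.Prime).two_le
  have key (s : ℕ) : ZMod.chineseRemainder hco ((g : ZMod (p * q)) ^ s * (x : ZMod (p * q)) ^ 1) =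
      ((g : ZMod p) ^ (s + 1), (g : ZMod q) ^ s) := by
    rw [map_mul, map_pow, map_pow, map_intCast, map_intCast]
    ext
    · simp [hxp, pow_succ]
    · simp [hxq]
  simp only [whitemanClass, mem_image, mem_range]
  constructor
  · rintro ⟨s, -, rfl⟩
    rw [key, hgp.quadraticChar_pow hp, hgq.quadraticChar_pow hq, ← pow_add]
    exact Odd.neg_one_pow ⟨s, by ring⟩
  · intro h
    have hj1 : (ZMod.chineseRemainder hco j).1 ≠ 0 := by
      intro h0; rw [h0] at h; simp at h
    have hj2 : (ZMod.chineseRemainder hco j).2 ≠ 0 := by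
      intro h0; rw [h0] at h; simp at h
    obtain ⟨a, ha, hja⟩ := hgp.exists_pow_eq (div_ne_zero hj1 hgp.ne_zero)
    obtain ⟨b, hb, hjb⟩ := hgq.exists_pow_eq hj2
    rw [eq_div_iff hgp.ne_zero, ← pow_succ] at hja
    rw [← hja, ← hjb, hgp.quadraticChar_pow hp, hgq.quadraticChar_pow hq, ← pow_add,
      neg_one_pow_eq_neg_one_iff_odd (by norm_num)] at h
    have hab : a ≡ b [MOD Nat.gcd (p - 1) (q - 1)] := by
      rw [hgcd, Nat.ModEq]
      rw [Nat.odd_iff] at h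
      omega
    -- The lcm of `p - 1` and `q - 1` is `(p - 1)(q - 1)/2`, exactly the range of `s` in `D_1`.
    have hlt := Nat.chineseRemainder'_lt_lcm hab (by omega) (by omega)
    obtain ⟨hsa, hsb⟩ := (Nat.chineseRemainder' hab).2
    set s := (Nat.chineseRemainder' hab : ℕ)
    refine ⟨s, by rwa [Nat.lcm, hgcd] at hlt, ?_⟩
    apply (ZMod.chineseRemainder hco).injective
    rw [key]
    ext
    · rw [← hja]
      exact hgp.pow_eq_pow (hsa.add_right 1)
    · rw [← hjb]
      exact hgq.pow_eq_pow hsb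

theorem chineseRemainder_intCast_mul_right {p q : ℕ} (hco : p.Coprime q) (z : ℤ) :
    ZMod.chineseRemainder hco ((z * (q : ℤ) : ℤ) : ZMod (p * q)) = ((z : ZMod p) * q, 0) := by
  rw [map_intCast]
  ext <;> simp

theorem chineseRemainder_intCast_mul_left {p q : ℕ} (hco : p.Coprime q) (z : ℤ) :
    ZMod.chineseRemainder hco ((z * (p : ℤ) : ℤ) : ZMod (p * q)) = (0, (z : ZMod q) * p) := by
  rw [map_intCast]
  ext <;> simp

theorem quadraticChar_div {p : ℕ} [Fact p.Prime] {y c : ZMod p} (hc : c ≠ 0) :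
    quadraticChar (ZMod p) (y / c) = quadraticChar (ZMod p) y * quadraticChar (ZMod p) c := by
  have h : y = y / c * c := by field_simp
  conv_rhs => rw [h, map_mul, mul_assoc, ← sq, quadraticChar_sq_one hc, mul_one]

theorem natCast_ne_zero_of_coprime {p q : ℕ} [Fact p.Prime] (hco : p.Coprime q) :
    (q : ZMod p) ≠ 0 := by
  rw [Ne, ZMod.natCast_eq_zero_iff]
  exact (Nat.Prime.coprime_iff_not_dvd Fact.out).mp hco

theorem mem_scaledClassP_one {p q : ℕ} [Fact p.Prime] (hp : p ≠ 2)
    (hco : p.Coprime q) {g : ℤ} (hgp : IsPrimitiveRootMod g p) (j : ZMod (p * q)) :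
    j ∈ scaledClassP p q g 1 ↔ (ZMod.chineseRemainder hco j).2 = 0 ∧
      quadraticChar (ZMod p) (ZMod.chineseRemainder hco j).1 *
        quadraticChar (ZMod p) (q : ZMod p) = -1 := by
  have hq0 := natCast_ne_zero_of_coprime hco
  rw [← quadraticChar_div hq0, ← mem_cyclotomicClass_one hgp hp]
  simp only [scaledClassP, mem_image]
  constructor
  · rintro ⟨z, hz, rfl⟩
    rw [chineseRemainder_intCast_mul_right]
    exact ⟨rfl, z, hz, by field_simp⟩
  · rintro ⟨h0, z, hz, h⟩
    refine ⟨z, hz, (ZMod.chineseRemainder hco).injective ?_⟩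
    rw [chineseRemainder_intCast_mul_right]
    ext
    · simp only [h]; field_simp
    · exact h0.symm

theorem mem_scaledClassQ_one {p q : ℕ} [Fact q.Prime] (hq : q ≠ 2)
    (hco : p.Coprime q) {g : ℤ} (hgq : IsPrimitiveRootMod g q) (j : ZMod (p * q)) :
    j ∈ scaledClassQ p q g 1 ↔ (ZMod.chineseRemainder hco j).1 = 0 ∧
      quadraticChar (ZMod q) (ZMod.chineseRemainder hco j).2 *
        quadraticChar (ZMod q) (p : ZMod q) = -1 := by
  have hp0 := natCast_ne_zero_of_coprime hco.symm
  rw [← quadraticChar_div hp0, ← mem_cyclotomicClass_one hgq hq]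
  simp only [scaledClassQ, mem_image]
  constructor
  · rintro ⟨z, hz, rfl⟩
    rw [chineseRemainder_intCast_mul_left]
    exact ⟨rfl, z, hz, by field_simp⟩
  · rintro ⟨h0, z, hz, h⟩
    refine ⟨z, hz, (ZMod.chineseRemainder hco).injective ?_⟩
    rw [chineseRemainder_intCast_mul_left]
    ext
    · exact h0.symm
    · simp only [h]; field_simp

/-- The `±1`-version of the indicator function of the support, in terms of quadratic characters. -/
theorem one_sub_two_mul_indicator_whitemanSupport {p q : ℕ} [Fact p.Prime] [Fact q.Prime]
    (hp : p ≠ 2) (hq : q ≠ 2) (hgcd : Nat.gcd (p - 1) (q - 1) = 2) (hco : p.Coprime q) {g x : ℤ}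
    (hgp : IsPrimitiveRootMod g p) (hgq : IsPrimitiveRootMod g q)
    (hxp : (x : ZMod p) = g) (hxq : (x : ZMod q) = 1) (a : ZMod p) (b : ZMod q) :
    (1 - 2 * if (ZMod.chineseRemainder hco).symm (a, b) ∈ whitemanSupport p q g x then 1 else 0 : ℤ)
      = (if a = 0 then 1 else 0) * (if b = 0 then 1 else 0)
        + quadraticChar (ZMod p) a * quadraticChar (ZMod q) b
        + quadraticChar (ZMod p) a * quadraticChar (ZMod p) (q : ZMod p) * (if b = 0 then 1 else 0)
        + (if a = 0 then 1 else 0) *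
          (quadraticChar (ZMod q) b * quadraticChar (ZMod q) (p : ZMod q)) := by
  simp only [whitemanSupport, mem_union, mem_whitemanClass_one hp hq hgcd hco hgp hgq hxp hxq,
    mem_scaledClassP_one hp hco hgp, mem_scaledClassQ_one hq hco hgq, RingEquiv.apply_symm_apply]
  -- In each case exactly one of the four summands is nonzero.
  by_cases ha : a = 0 <;> by_cases hb : b = 0
  · simp [ha, hb]
  · rcases quadraticChar_dichotomy hb with h | h <;>
    rcases quadraticChar_dichotomy (natCast_ne_zero_of_coprime hco.symm) with h' | h' <;>
    simp [ha, hb, h, h']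
  · rcases quadraticChar_dichotomy ha with h | h <;>
    rcases quadraticChar_dichotomy (natCast_ne_zero_of_coprime hco) with h' | h' <;>
    simp [ha, hb, h, h']
  · rcases quadraticChar_dichotomy ha with h | h <;>
    rcases quadraticChar_dichotomy hb with h' | h' <;>
    simp [ha, hb, h, h']

/-! ### Quadratic Gauss sums with values in a field -/

/-- The quadratic Gauss sum modulo `p` of an additive character with values in a field. -/
noncomputable def quadraticGaussSum (p : ℕ) [Fact p.Prime] {F : Type*} [Field F]
    (ψ : AddChar (ZMod p) F) : F :=
  gaussSum ((quadraticChar (ZMod p)).ringHomComp (Int.castRingHom F)) ψ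

theorem quadraticGaussSum_eq_sum (p : ℕ) [Fact p.Prime] {F : Type*} [Field F]
    (ψ : AddChar (ZMod p) F) :
    quadraticGaussSum p ψ = ∑ a, (quadraticChar (ZMod p) a : F) * ψ a := rfl

theorem ringHomComp_quadraticChar_ne_one {p : ℕ} [Fact p.Prime] (hp : p ≠ 2) {F : Type*} [Field F]
    (hF : (2 : F) ≠ 0) : (quadraticChar (ZMod p)).ringHomComp (Int.castRingHom F) ≠ 1 := by
  intro h
  obtain ⟨a, ha⟩ := quadraticChar_exists_neg_one' (F := ZMod p) (by rwa [ZMod.ringChar_zmod_n])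
  have h1 := congrArg (fun χ : MulChar (ZMod p) F => χ a) h
  simp only [MulChar.ringHomComp_apply, ha, MulChar.one_apply_coe, map_neg, map_one] at h1
  apply hF
  linear_combination -h1

theorem quadraticGaussSum_one {p : ℕ} [Fact p.Prime] (hp : p ≠ 2) {F : Type*} [Field F]
    (hF : (2 : F) ≠ 0) : quadraticGaussSum p (1 : AddChar (ZMod p) F) = 0 :=
  gaussSum_one_right (ringHomComp_quadraticChar_ne_one hp hF)

theorem quadraticGaussSum_sq {p : ℕ} [Fact p.Prime] (hp : p ≠ 2) {F : Type*} [Field F]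
    (hF : (2 : F) ≠ 0) {ψ : AddChar (ZMod p) F} (hψ : ψ ≠ 1) :
    quadraticGaussSum p ψ ^ 2 = (ZMod.χ₄ p : ℤ) * p := by
  rw [quadraticGaussSum, gaussSum_sq (ringHomComp_quadraticChar_ne_one hp hF)
    (MulChar.IsQuadratic.comp (quadraticChar_isQuadratic _) _) (AddChar.IsPrimitive.of_ne_one hψ),
    MulChar.ringHomComp_apply, quadraticChar_neg_one (by rwa [ZMod.ringChar_zmod_n]), ZMod.card]
  rfl

/-- A value of `ψ` other than 1 is an element of order `p` in the group `𝔽_r^×` of order `r - 1`. -/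
theorem dvd_sub_one_of_addChar_ne_one {p r : ℕ} [Fact p.Prime] [Fact r.Prime]
    {ψ : AddChar (ZMod p) (ZMod r)} (hψ : ψ ≠ 1) : p ∣ r - 1 := by
  obtain ⟨a, ha⟩ := AddChar.ne_one_iff.mp hψ
  have hpow : ψ a ^ p = 1 := by
    rw [← AddChar.map_nsmul_eq_pow, nsmul_eq_mul, CharP.cast_eq_zero, zero_mul,
      AddChar.map_zero_eq_one]
  have hne : ψ a ≠ 0 := by
    intro h
    rw [h, zero_pow (Fact.out : p.Prime).ne_zero] at hpow
    exact zero_ne_one hpow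
  rw [← orderOf_eq_prime hpow ha]
  exact ZMod.orderOf_dvd_card_sub_one hne

/-- If `1 + ε G = 0` for a quadratic Gauss sum `G` modulo `p` over `𝔽_r` and a sign `ε`, then
`p ∣ r - 1` and `(-1)^((p-1)/2) p = 1` in `𝔽_r`. -/
theorem of_one_add_mul_quadraticGaussSum_eq_zero {p r : ℕ} [Fact p.Prime] [Fact r.Prime]
    (hp : p ≠ 2) (hr : (2 : ZMod r) ≠ 0) {ψ : AddChar (ZMod p) (ZMod r)} {ε : ZMod r}
    (hε : ε ^ 2 = 1) (h : 1 + ε * quadraticGaussSum p ψ = 0) :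
    p ∣ r - 1 ∧ ((ZMod.χ₄ p : ℤ) * p : ZMod r) = 1 := by
  -- For trivial `ψ` the Gauss sum is 0 and the hypothesis would read `1 = 0`.
  have hψ : ψ ≠ 1 := by
    rintro rfl
    rw [quadraticGaussSum_one hp hr, mul_zero, add_zero] at h
    exact one_ne_zero h
  refine ⟨dvd_sub_one_of_addChar_ne_one hψ, ?_⟩
  rw [← quadraticGaussSum_sq hp hr hψ]
  linear_combination (-1 + ε * quadraticGaussSum p ψ) * h - quadraticGaussSum p ψ ^ 2 * hε

theorem exists_addChar_prod {p q : ℕ} (hco : p.Coprime q) {F : Type*} [Field F]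
    (ψ : AddChar (ZMod (p * q)) F) :
    ∃ (ψ₁ : AddChar (ZMod p) F) (ψ₂ : AddChar (ZMod q) F),
      ∀ a b, ψ ((ZMod.chineseRemainder hco).symm (a, b)) = ψ₁ a * ψ₂ b := by
  let f : ZMod p × ZMod q →+ ZMod (p * q) :=
    (ZMod.chineseRemainder hco).symm.toAddEquiv.toAddMonoidHom
  refine ⟨ψ.compAddMonoidHom (f.comp (AddMonoidHom.inl _ _)),
    ψ.compAddMonoidHom (f.comp (AddMonoidHom.inr _ _)), fun a b => ?_⟩
  have h : (a, b) = (a, 0) + (0, b) := by simp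
  rw [h, map_add, AddChar.map_add_eq_mul]
  rfl

/-! ### The character sum of the sequence and its vanishing modulo `r` -/

/-- The character sum of the `±1`-version of the sequence factors through two Gauss sums. -/
theorem sum_whitemanSupport_mul_addChar {p q : ℕ} [Fact p.Prime] [Fact q.Prime]
    (hp : p ≠ 2) (hq : q ≠ 2) (hgcd : Nat.gcd (p - 1) (q - 1) = 2) (hco : p.Coprime q) {g x : ℤ}
    (hgp : IsPrimitiveRootMod g p) (hgq : IsPrimitiveRootMod g q)
    (hxp : (x : ZMod p) = g) (hxq : (x : ZMod q) = 1) {F : Type*} [Field F]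
    (ψ : AddChar (ZMod (p * q)) F) :
    ∃ (ψ₁ : AddChar (ZMod p) F) (ψ₂ : AddChar (ZMod q) F),
      ∑ j, (1 - 2 * if j ∈ whitemanSupport p q g x then 1 else 0) * ψ j =
        1 + quadraticGaussSum p ψ₁ * quadraticGaussSum q ψ₂
          + quadraticChar (ZMod p) (q : ZMod p) * quadraticGaussSum p ψ₁
          + quadraticChar (ZMod q) (p : ZMod q) * quadraticGaussSum q ψ₂ := by
  obtain ⟨ψ₁, ψ₂, hψ⟩ := exists_addChar_prod hco ψ
  refine ⟨ψ₁, ψ₂, ?_⟩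
  rw [← (ZMod.chineseRemainder hco).symm.toEquiv.sum_comp, Fintype.sum_prod_type]
  have key (a : ZMod p) (b : ZMod q) :
      ((1 - 2 * if (ZMod.chineseRemainder hco).symm (a, b) ∈ whitemanSupport p q g x
        then 1 else 0) * ψ ((ZMod.chineseRemainder hco).symm (a, b)) : F) =
      ((if a = 0 then 1 else 0) * ψ₁ a) * ((if b = 0 then 1 else 0) * ψ₂ b)
        + (quadraticChar (ZMod p) a * ψ₁ a) * (quadraticChar (ZMod q) b * ψ₂ b)
        + quadraticChar (ZMod p) (q : ZMod p) *
          ((quadraticChar (ZMod p) a * ψ₁ a) * ((if b = 0 then 1 else 0) * ψ₂ b))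
        + quadraticChar (ZMod q) (p : ZMod q) *
          (((if a = 0 then 1 else 0) * ψ₁ a) * (quadraticChar (ZMod q) b * ψ₂ b)) := by
    have h := congrArg (Int.cast : ℤ → F)
      (one_sub_two_mul_indicator_whitemanSupport hp hq hgcd hco hgp hgq hxp hxq a b)
    push_cast at h
    rw [hψ, h]
    ring
  refine (sum_congr rfl fun a _ => sum_congr rfl fun b _ => key a b).trans ?_
  simp only [sum_add_distrib, ← mul_sum, ← sum_mul, ← quadraticGaussSum_eq_sum]
  simp

theorem prime_not_dvd_whitemanSequence_sum {p q : ℕ} (hp : p.Prime) (hq : q.Prime)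
    (hp4 : p ≡ 1 [MOD 4]) (hq4 : q ≡ 3 [MOD 4]) (hpq : q = p + 2)
    {g x : ℤ} (hgp : IsPrimitiveRootMod g p) (hgq : IsPrimitiveRootMod g q)
    (hxp : x ≡ g [ZMOD (p : ℤ)]) (hxq : x ≡ 1 [ZMOD (q : ℤ)]) {r : ℕ} (hr : r.Prime)
    (hS : r ∣ ∑ i ∈ range (p * q), whitemanSequence p q g x i * 2 ^ i)
    (hN : r ∣ 2 ^ (p * q) - 1) : False := by
  have : Fact p.Prime := ⟨hp⟩
  have : Fact q.Prime := ⟨hq⟩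
  have : Fact r.Prime := ⟨hr⟩
  have hp4' : p % 4 = 1 := hp4
  have hq4' : q % 4 = 3 := hq4
  have hp2 : p ≠ 2 := by omega
  have hq2 : q ≠ 2 := by omega
  have hp1 := hp.two_le
  have hr1 := hr.two_le
  have hco : p.Coprime q := (Nat.coprime_primes hp hq).mpr (by omega)
  have hgcd : Nat.gcd (p - 1) (q - 1) = 2 := by
    have h : q - 1 = 2 + (p - 1) := by omega
    rw [h, Nat.gcd_add_self_right]
    exact Nat.gcd_eq_right (by omega)
  have hxp' : (x : ZMod p) = g := (ZMod.intCast_eq_intCast_iff _ _ _).mpr hxp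
  have hxq' : (x : ZMod q) = 1 := by simpa using (ZMod.intCast_eq_intCast_iff _ _ _).mpr hxq
  have hpow : (2 : ZMod r) ^ (p * q) = 1 := by
    have h := (ZMod.natCast_eq_zero_iff _ _).mpr hN
    rw [Nat.cast_sub Nat.one_le_two_pow] at h
    push_cast at h
    exact sub_eq_zero.mp h
  have hr2 : (2 : ZMod r) ≠ 0 := by
    intro h
    rw [h, zero_pow (mul_ne_zero hp.ne_zero hq.ne_zero)] at hpow
    exact zero_ne_one hpow
  have hS' := (ZMod.natCast_eq_zero_iff _ _).mpr hS
  push_cast at hS'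
  have : NeZero (p * q) := ⟨mul_ne_zero hp.ne_zero hq.ne_zero⟩
  obtain ⟨ψ₁, ψ₂, h⟩ := sum_whitemanSupport_mul_addChar hp2 hq2 hgcd hco hgp hgq hxp' hxq'
    (AddChar.zmodChar (p * q) hpow)
  have hgeom : ∑ i ∈ range (p * q), (2 : ZMod r) ^ i = 0 := by
    have h := geom_sum_mul (2 : ZMod r) (p * q)
    rw [hpow] at h
    linear_combination h
  -- The sum is `∑ 2^i - 2 S`, and both terms vanish in `𝔽_r`. The geometric sum does so because it
  -- equals `2^N - 1`.
  have hzero : ∑ j, (1 - 2 * if j ∈ whitemanSupport p q g x then 1 else 0) *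
      AddChar.zmodChar (p * q) hpow j = 0 := by
    have : ∑ j, (1 - 2 * if j ∈ whitemanSupport p q g x then 1 else 0) *
        AddChar.zmodChar (p * q) hpow j =
        ∑ i ∈ range (p * q), (1 - 2 * (whitemanSequence p q g x i : ZMod r)) * 2 ^ i := by
      refine sum_nbij' ZMod.val (fun i => (i : ZMod (p * q)))
        (fun j _ => mem_range.mpr (ZMod.val_lt j)) (fun _ _ => mem_univ _)
        (fun j _ => ZMod.natCast_zmod_val j)
        (fun i hi => ZMod.val_cast_of_lt (mem_range.mp hi)) fun j _ => ?_
      rw [whitemanSequence, ZMod.natCast_zmod_val, AddChar.zmodChar_apply]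
      push_cast
      rfl
    rw [this]
    simp only [sub_mul, one_mul, sum_sub_distrib, hgeom, mul_assoc, ← mul_sum, hS']
    ring
  have hrec : quadraticChar (ZMod q) (p : ZMod q) = quadraticChar (ZMod p) (q : ZMod p) := by
    simpa [legendreSym] using legendreSym.quadratic_reciprocity_one_mod_four hp4' hq2
  have hsq : (quadraticChar (ZMod p) (q : ZMod p) : ZMod r) ^ 2 = 1 := by
    exact_mod_cast congrArg (Int.cast : ℤ → ZMod r)
      (quadraticChar_sq_one (natCast_ne_zero_of_coprime hco))
  rw [hzero, hrec] at h
  have hprod : (1 + (quadraticChar (ZMod p) (q : ZMod p) : ZMod r) * quadraticGaussSum p ψ₁) *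
      (1 + (quadraticChar (ZMod p) (q : ZMod p) : ZMod r) * quadraticGaussSum q ψ₂) = 0 := by
    linear_combination -h + quadraticGaussSum p ψ₁ * quadraticGaussSum q ψ₂ * hsq
  rcases mul_eq_zero.mp hprod with h0 | h0
  · obtain ⟨hdvd, heq⟩ := of_one_add_mul_quadraticGaussSum_eq_zero hp2 hr2 hsq h0
    rw [ZMod.χ₄_nat_one_mod_four hp4', Int.cast_one, one_mul] at heq
    have h1 : r ∣ p - 1 := by
      rw [← ZMod.natCast_eq_zero_iff, Nat.cast_sub hp.one_le, heq, Nat.cast_one, sub_self]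
    -- Contradiction: `p ≤ r - 1` and `r ≤ p - 1`.
    have h2 := Nat.le_of_dvd (by omega) hdvd
    have h3 := Nat.le_of_dvd (by omega) h1
    omega
  · obtain ⟨hdvd, heq⟩ := of_one_add_mul_quadraticGaussSum_eq_zero hq2 hr2 hsq h0
    rw [ZMod.χ₄_nat_three_mod_four hq4'] at heq
    have h1 : r ∣ q + 1 := by
      rw [← ZMod.natCast_eq_zero_iff]
      push_cast at heq ⊢
      linear_combination -heq
    have h2 := Nat.le_of_dvd (by omega) hdvd
    have h3 := Nat.le_of_dvd (by omega) h1
    -- From `q ≤ r - 1` and `r ≤ q + 1` it follows that `r = q + 1`, which is even and greater than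
    -- 2.
    rcases hr.eq_two_or_odd with h4 | h4 <;> omega

/-! ### From coprimality to maximal 2-adic complexity -/

theorem twoAdicComplexity_eq_of_coprime {N : ℕ} {s : ℕ → ℕ} (hN : 0 < N)
    (h : (∑ i ∈ range N, s i * 2 ^ i).Coprime (2 ^ N - 1)) : twoAdicComplexity N s = N := by
  have hpos : 0 < 2 ^ N - 1 := by
    have := Nat.one_lt_two_pow hN.ne'
    omega
  have hden : (((∑ i ∈ range N, s i * 2 ^ i : ℕ) : ℚ) / ((2 : ℚ) ^ N - 1)).den = 2 ^ N - 1 := by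
    have h1 := Rat.den_div_eq_of_coprime (a := ((∑ i ∈ range N, s i * 2 ^ i : ℕ) : ℤ))
      (b := ((2 ^ N - 1 : ℕ) : ℤ)) (by exact_mod_cast hpos) h
    rw [Int.cast_natCast, Int.cast_natCast, Nat.cast_sub Nat.one_le_two_pow] at h1
    push_cast [Nat.cast_sub Nat.one_le_two_pow] at h1 ⊢
    zify [Nat.one_le_two_pow (n := N)]
    exact h1
  rw [twoAdicComplexity, hden, Nat.cast_sub Nat.one_le_two_pow]
  push_cast
  rw [sub_add_cancel, Real.logb_pow, Real.logb_self_eq_one one_lt_two, mul_one, Nat.floor_natCast]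

end

theorem theorem2 (p q : ℕ) (hp : p.Prime) (hq : q.Prime)
    (hp4 : p ≡ 1 [MOD 4]) (hq4 : q ≡ 3 [MOD 4]) (hpq : q = p + 2)
    (g x : ℤ) (hgp : IsPrimitiveRootMod g p) (hgq : IsPrimitiveRootMod g q)
    (hxp : x ≡ g [ZMOD (p : ℤ)]) (hxq : x ≡ 1 [ZMOD (q : ℤ)]) :
    twoAdicComplexity (p * q) (whitemanSequence p q g x) = p * q := by
  refine twoAdicComplexity_eq_of_coprime (Nat.mul_pos hp.pos hq.pos) ?_
  exact Nat.coprime_of_dvd fun r hr hS hN =>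
    prime_not_dvd_whitemanSequence_sum hp hq hp4 hq4 hpq hgp hgq hxp hxq hr hS hN
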